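/- For an integer $n\ge 2$ put $d_n=p$ if $n=p^m$ is a power of a prime $p$ with $m\ge 1$, and $d_n=1$ if $n$ is not a prime power, and let $$S(B_n)=\left\langle \tfrac1{d_n}\tbinom n1,\tfrac1{d_n}\tbinom n2,\dots,\tfrac1{d_n}\tbinom n{n-1}\right\rangle$$ be the submonoid of $(\mathbb N,+)$, $\mathbb N=\{0,1,2,\dots\}$, generated by these integers. Then, for every $n\ge 2$, $S(B_n)$ is a numerical semigroup (that is, $\mathbb N\setminus S(B_n)$ is finite), it is telescopic, and it is a complete intersection. Here let $g_1<\dots<g_e$ be the minimal system of generators of a numerical semigroup $S$. The semigroup $S$ is called telescopic if, with $d_i=\gcd(g_1,\dots,g_i)$, one has $g_i/d_i\in\langle g_1/d_{i-1},\dots,g_{i-1}/d_{i-1}\rangle$ for all $2\le i\le e$. A presentation of $S$ is a set $\rho\subseteq\mathbb N^e\times\mathbb N^e$ such that the congruence on $\mathbb N^e$ generated by $\rho$ is the kernel congruence of $\mathbb N^e\to S$, $(c_1,\dots,c_e)\mapsto\sum_i c_ig_i$; and $S$ is called a complete intersection if the smallest cardinality of a presentation of $S$ is $e-1$. -/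

import Mathlib

/-- A submonoid of `(ℕ, +)` is a numerical semigroup if its complement in `ℕ` is finite. -/
def IsNumericalSemigroup (S : AddSubmonoid ℕ) : Prop :=
  ((S : Set ℕ)ᶜ).Finite

/-- `A` is a minimal system of generators of `S`: it generates `S`, and no proper subset does. -/
def IsMinimalGeneratingSystem (S : AddSubmonoid ℕ) (A : Set ℕ) : Prop :=
  AddSubmonoid.closure A = S ∧ ∀ X : Set ℕ, X ⊂ A → AddSubmonoid.closure X ≠ S

/-- `g 0 < g 1 < ⋯ < g (e - 1)` is the minimal system of generators of `S`, in increasing order.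
In particular `e` is the embedding dimension of `S`. -/
def IsMinimalGeneratorSequence (S : AddSubmonoid ℕ) {e : ℕ} (g : Fin e → ℕ) : Prop :=
  StrictMono g ∧ IsMinimalGeneratingSystem S (Set.range g)

/-- `S` is telescopic: if `g 0 < g 1 < ⋯ < g (e - 1)` are its minimal generators and
`d i = gcd (g 0, …, g i)`, then `g i / d i` lies in the submonoid generated by
`g 0 / d (i - 1), …, g (i - 1) / d (i - 1)`, for every `i` with `1 ≤ i ≤ e - 1`. -/
def IsTelescopic (S : AddSubmonoid ℕ) : Prop :=
  ∃ (e : ℕ) (g : Fin e → ℕ), IsMinimalGeneratorSequence S g ∧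
    ∀ i : Fin e, 0 < (i : ℕ) →
      g i / (Finset.Iic i).gcd g ∈
        AddSubmonoid.closure ((fun j : Fin e => g j / (Finset.Iio i).gcd g) '' Set.Iio i)

/-- The homomorphism `ℕᵉ → ℕ`, `(c₀, …, c_{e-1}) ↦ ∑ cᵢ gᵢ`. -/
def factorizationHom {e : ℕ} (g : Fin e → ℕ) : (Fin e → ℕ) →+ ℕ where
  toFun c := ∑ i, c i * g i
  map_zero' := by simp
  map_add' a b := by simp [add_mul, Finset.sum_add_distrib]

/-- A set `ρ` of pairs of elements of `ℕᵉ` is a presentation of the monoid generated by `g` if the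
congruence on `ℕᵉ` generated by `ρ` is the kernel congruence of `(cᵢ) ↦ ∑ cᵢ gᵢ`. -/
def IsPresentation {e : ℕ} (g : Fin e → ℕ) (ρ : Set ((Fin e → ℕ) × (Fin e → ℕ))) : Prop :=
  addConGen (fun u v => (u, v) ∈ ρ) = AddCon.ker (factorizationHom g)

/-- `S` is a complete intersection: the smallest number of relations in a presentation of `S` with
respect to its minimal generators is the embedding dimension minus one. -/
def IsCompleteIntersection (S : AddSubmonoid ℕ) : Prop :=
  ∃ (e : ℕ) (g : Fin e → ℕ), IsMinimalGeneratorSequence S g ∧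
    ∃ r : ℕ, r + 1 = e ∧
      IsLeast {k : ℕ | ∃ ρ : Finset ((Fin e → ℕ) × (Fin e → ℕ)),
        ρ.card = k ∧ IsPresentation g (ρ : Set ((Fin e → ℕ) × (Fin e → ℕ)))} r

open Classical in
/-- The number by which the binomial coefficients are divided: `p` if `n = p ^ m` with `p` prime
and `m ≥ 1`, and `1` if `n` is not a prime power. -/
noncomputable def binomialDivisor (n : ℕ) : ℕ :=
  if IsPrimePow n then n.minFac else 1

theorem binomialDivisor_prime_pow {p m : ℕ} (hp : p.Prime) (hm : 1 ≤ m) :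
    binomialDivisor (p ^ m) = p := by
  have hm' : m ≠ 0 := by omega
  rw [binomialDivisor, if_pos (hp.isPrimePow.pow hm'), hp.pow_minFac hm']

theorem binomialDivisor_of_not_isPrimePow {n : ℕ} (hn : ¬ IsPrimePow n) :
    binomialDivisor n = 1 := if_neg hn

/-- The division in `binomialSemigroup` is exact. -/
theorem binomialDivisor_dvd_choose {n k : ℕ} (hk : 0 < k) (hkn : k < n) :
    binomialDivisor n ∣ n.choose k := by
  by_cases h : IsPrimePow n
  · obtain ⟨p, m, hp, hm, rfl⟩ := (isPrimePow_nat_iff n).1 h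
    rw [binomialDivisor_prime_pow hp hm]
    exact hp.dvd_choose_pow hk.ne' hkn.ne
  · rw [binomialDivisor_of_not_isPrimePow h]
    exact one_dvd _

/-- `S(B_n)`: the submonoid of `ℕ` generated by the binomial coefficients `n.choose k`,
`1 ≤ k ≤ n - 1`, each divided by `p` when `n` is a power of the prime `p`. -/
noncomputable def binomialSemigroup (n : ℕ) : AddSubmonoid ℕ :=
  AddSubmonoid.closure ((fun k : ℕ => n.choose k / binomialDivisor n) '' Set.Ioo 0 n)

/-! Write G(k) for the normalized coefficient. The minimal generators are the G(q) with q a proper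
divisor of n equal to 1 or a prime power. Everything rests on k·G(k) = G(1)·C(n-1, k-1) and on p ∤
C(n-1, q-1) for a power q of p dividing n. If G(1) ∣ m·x with m a proper divisor of n, multiples of
the G(q), q ∣ m, can be subtracted from x to remove the primes of m one at a time, until a multiple
of G(1) remains; x only has to be large enough (`mem_closure_normalizedChoose_of_sum_le`). Growth of
binomial coefficients supplies the size, so every G(k) is generated, and for q a power of p, p·G(q)
is generated by the earlier generators. Conversely, if the gcd of the earlier generators divides
t·G(q), then p ∣ t (`minFac_dvd_of_gcd_dvd_mul`). These two facts give minimality and telescopicity,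
and a presentation with one relation per generator after the first; a rank count shows that fewer
cannot suffice. Finiteness of the complement amounts to the generators having gcd 1. -/

/-! ### Growth estimates for binomial coefficients. -/

theorem Nat.choose_lt_choose_of_two_mul_le {n a b : ℕ} (hab : a < b) (hb : 2 * b ≤ n) :
    n.choose a < n.choose b := by
  induction b, hab using Nat.le_induction with
  | base =>
    have h := Nat.choose_succ_right_eq n a
    have hpos : 0 < n.choose a := Nat.choose_pos (by omega)
    have : n.choose a * (a + 1) < n.choose a * (n - a) :=
      Nat.mul_lt_mul_of_pos_left (by omega) hpos
    exact Nat.lt_of_mul_lt_mul_right (h ▸ this)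
  | succ b hab ih =>
    exact (ih (by omega)).trans_le (Nat.choose_le_succ_of_lt_half_left (by omega))

theorem Nat.choose_le_choose_of_two_mul_le {n a b : ℕ} (hab : a ≤ b) (hb : 2 * b ≤ n) :
    n.choose a ≤ n.choose b := by
  rcases hab.eq_or_lt with rfl | h
  · exact le_rfl
  · exact (Nat.choose_lt_choose_of_two_mul_le h hb).le

/-- Consecutive terms grow by a factor at least 3 in this range, so a geometric series bounds the
sum. -/
theorem two_mul_sum_choose_le {n h : ℕ} (hn : 4 * h ≤ n) :
    2 * ∑ j ∈ Finset.range (h + 1), n.choose j ≤ 3 * n.choose h := by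
  induction h with
  | zero => simp
  | succ h ih =>
    rw [Finset.sum_range_succ]
    have h1 := ih (by omega)
    have h2 : 3 * n.choose h ≤ n.choose (h + 1) := by
      refine Nat.le_of_mul_le_mul_right (c := h + 1) ?_ (by omega)
      rw [Nat.choose_succ_right_eq, mul_comm 3, mul_assoc]
      exact Nat.mul_le_mul_left _ (by omega)
    omega

/-- Factor by factor: 3(L - i) ≤ 2(M - i) persists as i grows. -/
theorem three_pow_mul_descFactorial_le {L M : ℕ} (hLM : 3 * L ≤ 2 * M) (i : ℕ) :
    3 ^ i * L.descFactorial i ≤ 2 ^ i * M.descFactorial i := by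
  induction i with
  | zero => simp
  | succ i ih =>
    calc 3 ^ (i + 1) * L.descFactorial (i + 1)
        = (3 * (L - i)) * (3 ^ i * L.descFactorial i) := by
          rw [Nat.descFactorial_succ]; ring
      _ ≤ (2 * (M - i)) * (2 ^ i * M.descFactorial i) := Nat.mul_le_mul (by omega) ih
      _ = 2 ^ (i + 1) * M.descFactorial (i + 1) := by
          rw [Nat.descFactorial_succ]; ring

theorem three_pow_mul_choose_le {L M : ℕ} (hLM : 3 * L ≤ 2 * M) (i : ℕ) :
    3 ^ i * L.choose i ≤ 2 ^ i * M.choose i := by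
  have h := three_pow_mul_descFactorial_le hLM i
  rw [Nat.descFactorial_eq_factorial_mul_choose, Nat.descFactorial_eq_factorial_mul_choose] at h
  refine le_of_mul_le_mul_left (a := i.factorial) ?_ i.factorial_pos
  linarith

/-- Use C(n,2h)·C(2h,h) = C(n,h)·C(n-h,h) and compare C(2h,h) with C(n-h,h). -/
theorem three_pow_mul_choose_le_choose_two_mul {n h : ℕ} (hn : 4 * h ≤ n) :
    3 ^ h * n.choose h ≤ 2 ^ h * n.choose (2 * h) := by
  have h1 := Nat.choose_mul (n := n) (k := 2 * h) (s := h) (by omega)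
  have h2 := three_pow_mul_choose_le (L := 2 * h) (M := n - h) (by omega) h
  rw [show 2 * h - h = h by omega] at h1
  refine Nat.le_of_mul_le_mul_right (c := (2 * h).choose h) ?_ (Nat.choose_pos (by omega))
  calc 3 ^ h * n.choose h * (2 * h).choose h
      = n.choose h * (3 ^ h * (2 * h).choose h) := by ring
    _ ≤ n.choose h * (2 ^ h * (n - h).choose h) := Nat.mul_le_mul_left _ h2
    _ = 2 ^ h * (n.choose h * (n - h).choose h) := by ring
    _ = 2 ^ h * n.choose (2 * h) * (2 * h).choose h := by rw [← h1]; ring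

theorem mul_two_pow_le_three_pow (t : ℕ) : t * 2 ^ t ≤ 3 ^ t := by
  induction t with
  | zero => simp
  | succ t ih =>
    rcases Nat.lt_or_ge t 2 with h | h
    · interval_cases t <;> norm_num
    · calc (t + 1) * 2 ^ (t + 1) = (2 * t + 2) * 2 ^ t := by ring
        _ ≤ (3 * t) * 2 ^ t := Nat.mul_le_mul_right _ (by omega)
        _ = 3 * (t * 2 ^ t) := by ring
        _ ≤ 3 * 3 ^ t := Nat.mul_le_mul_left _ ih
        _ = 3 ^ (t + 1) := by ring

/-- For h = t + 1 the sum is at most t·(3/2)·C(n,h) ≤ t·(2/3)^t·C(n,2h), and t·(2/3)^t ≤ 1. -/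
theorem sum_pred_mul_choose_le {n h k : ℕ} (hk : 2 * h ≤ k) (hn : 2 * k ≤ n) :
    ∑ j ∈ Finset.range (h + 1), (j - 1) * n.choose j ≤ n.choose k := by
  refine le_trans ?_ (Nat.choose_le_choose_of_two_mul_le hk hn)
  rcases h with _ | t
  · simp
  have h4 : 4 * (t + 1) ≤ n := by omega
  have h1 : ∑ j ∈ Finset.range (t + 1 + 1), (j - 1) * n.choose j ≤
      t * ∑ j ∈ Finset.range (t + 1 + 1), n.choose j := by
    rw [Finset.mul_sum]
    refine Finset.sum_le_sum fun j hj => Nat.mul_le_mul_right _ ?_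
    have := Finset.mem_range.1 hj
    omega
  have h2 := two_mul_sum_choose_le h4
  have h3 := three_pow_mul_choose_le_choose_two_mul h4
  have h5 := mul_two_pow_le_three_pow t
  set A := ∑ j ∈ Finset.range (t + 1 + 1), (j - 1) * n.choose j
  set B := ∑ j ∈ Finset.range (t + 1 + 1), n.choose j
  refine le_of_mul_le_mul_left (a := 2 ^ (t + 1)) ?_ (by positivity)
  calc 2 ^ (t + 1) * A ≤ 2 ^ (t + 1) * (t * B) := Nat.mul_le_mul_left _ h1
    _ = t * 2 ^ t * (2 * B) := by ring
    _ ≤ 3 ^ t * (3 * n.choose (t + 1)) := Nat.mul_le_mul h5 h2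
    _ = 3 ^ (t + 1) * n.choose (t + 1) := by ring
    _ ≤ _ := h3

/-! ### A nondivisibility from Lucas' theorem. -/

/-- In base p, px - 1 has last digit p - 1 and remaining part x - 1, so each application of Lucas'
congruence strips a factor C(p-1, p-1) = 1 and lowers a by one. -/
theorem not_dvd_choose_pred_prime_pow_pred {p : ℕ} (hp : p.Prime) (a : ℕ) :
    ∀ {n : ℕ}, 0 < n → p ^ a ∣ n → ¬ p ∣ (n - 1).choose (p ^ a - 1) := by
  induction a with
  | zero => intro n _ _; simpa using hp.one_lt.ne'
  | succ a ih =>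
    rintro n hn ⟨m, rfl⟩
    have : Fact p.Prime := ⟨hp⟩
    have key : ∀ x, 0 < x → (p * x - 1) % p = p - 1 ∧ (p * x - 1) / p = x - 1 := by
      intro x hx
      obtain ⟨y, rfl⟩ := Nat.exists_eq_add_of_le' hx
      have h1 : p * (y + 1) - 1 = (p - 1) + p * y := by
        have := hp.pos
        rw [mul_add]; omega
      have h2 : p - 1 < p := Nat.sub_lt hp.pos one_pos
      rw [h1, Nat.add_mul_mod_self_left, Nat.add_mul_div_left _ _ hp.pos, Nat.mod_eq_of_lt h2,
        Nat.div_eq_of_lt h2]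
      simp
    have hpa : 0 < p ^ a := pow_pos hp.pos a
    have hm : 0 < p ^ a * m := Nat.mul_pos hpa (Nat.pos_of_mul_pos_left hn)
    have h := Choose.choose_modEq_choose_mod_mul_choose_div_nat (p := p)
      (n := p * (p ^ a * m) - 1) (k := p * p ^ a - 1)
    rw [(key _ hm).1, (key _ hm).2, (key _ hpa).1, (key _ hpa).2, Nat.choose_self, one_mul] at h
    rw [pow_succ', mul_assoc, h.dvd_iff dvd_rfl]
    exact ih hm (dvd_mul_right _ _)

/-! ### Minimality and telescopicity from gcd conditions. -/

/-- A sum of the other generators either uses only smaller ones, hence is divisible by their gcd, or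
exceeds `g i`. -/
theorem not_mem_closure_of_not_gcd_dvd {e : ℕ} {g : Fin e → ℕ} (hg : StrictMono g) {i : Fin e}
    (hi : ¬ (Finset.Iio i).gcd g ∣ g i) :
    g i ∉ AddSubmonoid.closure (Set.range g \ {g i}) := by
  intro hmem
  have key : ∀ x ∈ AddSubmonoid.closure (Set.range g \ {g i}),
      (Finset.Iio i).gcd g ∣ x ∨ g i < x := by
    intro x hx
    induction hx using AddSubmonoid.closure_induction with
    | mem x hx =>
      obtain ⟨⟨j, rfl⟩, hj⟩ := hx
      rcases lt_trichotomy j i with h | rfl | h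
      · exact Or.inl (Finset.gcd_dvd (Finset.mem_Iio.2 h))
      · exact absurd rfl hj
      · exact Or.inr (hg h)
    | zero => exact Or.inl (dvd_zero _)
    | add x y _ _ hx hy =>
      rcases hx with hx | hx
      · rcases hy with hy | hy
        · exact Or.inl (dvd_add hx hy)
        · exact Or.inr (by omega)
      · exact Or.inr (by omega)
  rcases key _ hmem with h | h
  · exact hi h
  · exact lt_irrefl _ h

theorem isMinimalGeneratorSequence_of_not_gcd_dvd {e : ℕ} {g : Fin e → ℕ} (hg : StrictMono g)
    (hndvd : ∀ i, ¬ (Finset.Iio i).gcd g ∣ g i) :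
    IsMinimalGeneratorSequence (AddSubmonoid.closure (Set.range g)) g := by
  refine ⟨hg, rfl, fun X hX hcl => ?_⟩
  obtain ⟨_, ⟨i, rfl⟩, hi⟩ := Set.exists_of_ssubset hX
  refine not_mem_closure_of_not_gcd_dvd hg (hndvd i)
    (AddSubmonoid.closure_mono (t := Set.range g \ {g i}) (fun x hx => ⟨hX.1 hx, ?_⟩)
      (hcl ▸ AddSubmonoid.subset_closure ⟨i, rfl⟩))
  rintro rfl
  exact hi hx

theorem div_mem_closure_image_div {ι : Type*} {g : ι → ℕ} {s : Set ι} {d x : ℕ}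
    (hd : ∀ j ∈ s, d ∣ g j) (hx : x ∈ AddSubmonoid.closure (g '' s)) :
    d ∣ x ∧ x / d ∈ AddSubmonoid.closure ((fun j => g j / d) '' s) := by
  induction hx using AddSubmonoid.closure_induction with
  | mem x hx =>
    obtain ⟨j, hj, rfl⟩ := hx
    exact ⟨hd j hj, AddSubmonoid.subset_closure ⟨j, hj, rfl⟩⟩
  | zero => simp
  | add x y _ _ hx hy =>
    refine ⟨dvd_add hx.1 hy.1, ?_⟩
    rw [Nat.add_div_of_dvd_right hx.1]
    exact add_mem hx.2 hy.2

/-- With D the gcd of the earlier generators and c = gcd(`g i`, D), the hypotheses force `p i` = D /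
c for i > 0; hence `g i` / c = `p i * g i` / D. -/
theorem isTelescopic_of_mul_mem_closure {e : ℕ} {g p : Fin e → ℕ} (hg : StrictMono g)
    (hpos : ∀ i, 0 < g i) (hndvd : ∀ i, ¬ (Finset.Iio i).gcd g ∣ g i)
    (hmem : ∀ i, p i * g i ∈ AddSubmonoid.closure (g '' Set.Iio i))
    (hdvd : ∀ i t, (Finset.Iio i).gcd g ∣ t * g i → p i ∣ t) :
    IsTelescopic (AddSubmonoid.closure (Set.range g)) := by
  refine ⟨e, g, isMinimalGeneratorSequence_of_not_gcd_dvd hg hndvd, fun i hi => ?_⟩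
  set D := (Finset.Iio i).gcd g with hD
  have hmem' := div_mem_closure_image_div (d := D)
    (fun j hj => Finset.gcd_dvd (Finset.mem_Iio.2 hj)) (hmem i)
  have hIic : (Finset.Iic i).gcd g = Nat.gcd (g i) D := by
    rw [← Finset.Iio_insert, Finset.gcd_insert]
    rfl
  have hDpos : 0 < D := by
    refine Nat.pos_of_ne_zero fun h0 => ?_
    have := (Finset.gcd_eq_zero_iff.1 (hD ▸ h0)) ⟨0, by omega⟩ (Finset.mem_Iio.2 hi)
    exact (hpos _).ne' this
  set c := Nat.gcd (g i) D with hc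
  have hcpos : 0 < c := Nat.gcd_pos_of_pos_left _ (hpos i)
  obtain ⟨a, ha⟩ : c ∣ g i := Nat.gcd_dvd_left _ _
  obtain ⟨b, hb⟩ : c ∣ D := Nat.gcd_dvd_right _ _
  have hpb : p i ∣ b := hdvd i b ⟨a, by rw [ha, ← hD, hb]; ring⟩
  have hab : Nat.Coprime b a := by
    have : c * Nat.gcd a b = c * 1 := by rw [← Nat.gcd_mul_left, ← ha, ← hb, mul_one]
    rw [Nat.coprime_comm]
    exact Nat.eq_of_mul_eq_mul_left hcpos this
  have hbp : b ∣ p i := by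
    refine hab.dvd_of_dvd_mul_right ?_
    refine Nat.dvd_of_mul_dvd_mul_left hcpos ?_
    rw [← hb, show c * (p i * a) = p i * (c * a) by ring, ← ha]
    exact hmem'.1
  have hpeq : p i = b := Nat.dvd_antisymm hpb hbp
  have hbpos : 0 < b := Nat.pos_of_ne_zero fun h => by simp [h] at hb; omega
  have hval : g i / c = p i * g i / D := by
    rw [hpeq, hb, ha, Nat.mul_div_cancel_left _ hcpos, show b * (c * a) = c * b * a by ring,
      Nat.mul_div_cancel_left _ (Nat.mul_pos hcpos hbpos)]
  rw [hIic, hval]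
  exact hmem'.2

/-! ### Presentations: triangular relations and the rank bound. -/

theorem exists_factorization_of_mem_closure {e : ℕ} {g : Fin e → ℕ} {s : Set (Fin e)} {x : ℕ}
    (hx : x ∈ AddSubmonoid.closure (g '' s)) :
    ∃ c : Fin e → ℕ, (∀ j, j ∉ s → c j = 0) ∧ factorizationHom g c = x := by
  induction hx using AddSubmonoid.closure_induction with
  | mem x hx =>
    obtain ⟨j, hj, rfl⟩ := hx
    refine ⟨Pi.single j 1, fun i hi => Pi.single_eq_of_ne (by rintro rfl; exact hi hj) _, ?_⟩
    simp [factorizationHom, Pi.single_apply]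
  | zero => exact ⟨0, by simp, map_zero _⟩
  | add x y _ _ hx hy =>
    obtain ⟨c, hc, rfl⟩ := hx
    obtain ⟨c', hc', rfl⟩ := hy
    exact ⟨c + c', fun j hj => by simp [hc j hj, hc' j hj], map_add _ _ _⟩

theorem gcd_dvd_factorizationHom {e : ℕ} (g : Fin e → ℕ) {i : Fin e} {x : Fin e → ℕ}
    (hx : ∀ j, i ≤ j → x j = 0) : (Finset.Iio i).gcd g ∣ factorizationHom g x := by
  change _ ∣ ∑ j, x j * g j
  refine Finset.dvd_sum fun j _ => ?_
  by_cases h : i ≤ j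
  · simp [hx j h]
  · exact (Finset.gcd_dvd (Finset.mem_Iio.2 (not_le.1 h))).mul_left _

theorem factorizationHom_single {e : ℕ} (g : Fin e → ℕ) (i : Fin e) (a : ℕ) :
    factorizationHom g (Pi.single i a) = a * g i := by
  simp [factorizationHom, Pi.single_apply]

/-- Induction on the number of coordinates allowed to be nonzero. The top coordinates of x and y
differ by a multiple of `p i`, and the relation at `i` moves that difference into lower coordinates.
-/
theorem addCon_of_factorizationHom_eq {e : ℕ} {g p : Fin e → ℕ} {r : Fin e → Fin e → ℕ}
    (C : AddCon (Fin e → ℕ)) (hr : ∀ i j, i ≤ j → r i j = 0)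
    (hrg : ∀ i, factorizationHom g (r i) = p i * g i)
    (hC : ∀ i, C (Pi.single i (p i)) (r i))
    (hdvd : ∀ i t, (Finset.Iio i).gcd g ∣ t * g i → p i ∣ t) (k : ℕ) (hk : k ≤ e) :
    ∀ x y : Fin e → ℕ, (∀ j : Fin e, k ≤ j → x j = 0) → (∀ j : Fin e, k ≤ j → y j = 0) →
      factorizationHom g x = factorizationHom g y → C x y := by
  induction k with
  | zero =>
    intro x y hx hy _
    have : x = y := funext fun j => by rw [hx j (Nat.zero_le _), hy j (Nat.zero_le _)]
    exact this ▸ C.refl _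
  | succ k ih =>
    let i : Fin e := ⟨k, hk⟩
    have main : ∀ x y : Fin e → ℕ, (∀ j : Fin e, k + 1 ≤ j → x j = 0) →
        (∀ j : Fin e, k + 1 ≤ j → y j = 0) → factorizationHom g x = factorizationHom g y →
        x i ≤ y i → C x y := by
      intro x y hx hy hxy hle
      have split : ∀ z : Fin e → ℕ, z = Function.update z i 0 + Pi.single i (z i) := by
        intro z
        funext j
        by_cases h : j = i
        · subst h; simp
        · simp [h]
      have supp : ∀ z : Fin e → ℕ, (∀ j : Fin e, k + 1 ≤ j → z j = 0) →
          ∀ j : Fin e, i ≤ j → Function.update z i 0 j = 0 := by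
        intro z hz j hj
        by_cases h : j = i
        · subst h; simp
        · rw [Function.update_of_ne h]
          exact hz j (Nat.lt_of_le_of_ne hj fun h' => h (Fin.ext h'.symm))
      obtain ⟨t, ht⟩ := Nat.exists_eq_add_of_le hle
      set x' := Function.update x i 0 with hx'
      set y' := Function.update y i 0 with hy'
      have hsum : factorizationHom g x' = factorizationHom g y' + t * g i := by
        have h1 := congrArg (factorizationHom g) (split x)
        have h2 := congrArg (factorizationHom g) (split y)
        rw [map_add, factorizationHom_single, ← hx'] at h1
        rw [map_add, factorizationHom_single, ← hy', ht, add_mul] at h2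
        omega
      obtain ⟨s, hs⟩ : p i ∣ t := by
        refine hdvd i t ((Nat.dvd_add_right (gcd_dvd_factorizationHom g (supp y hy))).1 ?_)
        rw [← hy', ← hsum]
        exact gcd_dvd_factorizationHom g (supp x hx)
      have h1 : C x' (y' + s • r i) := by
        refine ih (Nat.le_of_succ_le hk) _ _ (supp x hx) (fun j hj => ?_) ?_
        · have h1 : y' j = 0 := supp y hy j hj
          have h2 : r i j = 0 := hr i j hj
          simp [h1, h2]
        · rw [map_add, map_nsmul, hrg, hsum, hs, smul_eq_mul]
          ring
      have h2 : C (s • r i) (Pi.single i t) := by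
        have := C.nsmul s (C.symm (hC i))
        rwa [← Pi.single_smul', smul_eq_mul, mul_comm s, ← hs] at this
      have h3 : C x (y' + Pi.single i t + Pi.single i (x i)) := by
        have := C.add (C.trans h1 (C.add (C.refl y') h2)) (C.refl (Pi.single i (x i)))
        rwa [← split x] at this
      rwa [add_assoc, ← Pi.single_add, add_comm t, ← ht, ← split y] at h3
    intro x y hx hy hxy
    rcases le_total (x i) (y i) with h | h
    · exact main x y hx hy hxy h
    · exact C.symm (main y x hy hx hxy.symm h)

/-- Over ℚ, let W be the span of the differences of the relations. It contains g₀eᵢ - gᵢe₀ for all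
i, so W and e₀ span the whole space and dim W ≥ r. -/
theorem le_card_of_isPresentation {r : ℕ} {g : Fin (r + 1) → ℕ} (hpos : 0 < g 0)
    {ρ : Finset ((Fin (r + 1) → ℕ) × (Fin (r + 1) → ℕ))}
    (hρ : IsPresentation g (ρ : Set ((Fin (r + 1) → ℕ) × (Fin (r + 1) → ℕ)))) : r ≤ ρ.card := by
  classical
  let v : (Fin (r + 1) → ℕ) → (Fin (r + 1) → ℚ) := fun x j => (x j : ℚ)
  have hv : ∀ x y, v (x + y) = v x + v y := fun x y => by funext j; simp [v]
  let T : Finset (Fin (r + 1) → ℚ) := ρ.image fun u => v u.1 - v u.2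
  let W : Submodule ℚ (Fin (r + 1) → ℚ) := Submodule.span ℚ (T : Set (Fin (r + 1) → ℚ))
  let C : AddCon (Fin (r + 1) → ℕ) :=
    { r := fun x y => v x - v y ∈ W
      iseqv :=
        { refl := fun x => by simp
          symm := fun {x y} h => by simpa using W.neg_mem h
          trans := fun {x y z} h h' => by simpa using W.add_mem h h' }
      add' := fun {a b c d} h h' => by
        have := W.add_mem h h'
        rw [hv, hv]
        convert this using 1
        abel }
  have hle : AddCon.ker (factorizationHom g) ≤ C := by
    rw [← hρ]
    refine AddCon.addConGen_le.2 fun x y hxy => ?_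
    exact Submodule.subset_span (Finset.mem_coe.2 (Finset.mem_image.2 ⟨(x, y), hxy, rfl⟩))
  have hsingle : ∀ (i : Fin (r + 1)) (a : ℕ), v (Pi.single i a) = (a : ℚ) • Pi.single i 1 := by
    intro i a
    funext j
    by_cases h : j = i
    · subst h; simp [v]
    · simp [v, h]
  have htop : W ⊔ Submodule.span ℚ {(Pi.single 0 1 : Fin (r + 1) → ℚ)} = ⊤ := by
    refine eq_top_iff.2 ?_
    rw [← (Pi.basisFun ℚ (Fin (r + 1))).span_eq, Submodule.span_le]
    rintro _ ⟨i, rfl⟩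
    rw [Pi.basisFun_apply]
    have hker : C (Pi.single i (g 0)) (Pi.single 0 (g i)) := by
      refine hle ?_
      rw [AddCon.ker_rel, factorizationHom_single, factorizationHom_single, mul_comm]
    have hker' : (g 0 : ℚ) • (Pi.single i 1 : Fin (r + 1) → ℚ) - (g i : ℚ) • Pi.single 0 1 ∈ W := by
      rw [← hsingle, ← hsingle]
      exact hker
    have hg0 : (g 0 : ℚ) ≠ 0 := by exact_mod_cast hpos.ne'
    have h1 := Submodule.add_mem_sup hker' (Submodule.smul_mem
      (Submodule.span ℚ {(Pi.single 0 1 : Fin (r + 1) → ℚ)}) (g i : ℚ)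
      (Submodule.mem_span_singleton_self _))
    rw [sub_add_cancel] at h1
    exact (Submodule.smul_mem_iff _ hg0).1 h1
  have h1 := Submodule.finrank_add_le_finrank_add_finrank W
    (Submodule.span ℚ {(Pi.single 0 1 : Fin (r + 1) → ℚ)})
  rw [htop, finrank_top, Module.finrank_fin_fun] at h1
  have h2 : Module.finrank ℚ W ≤ T.card := finrank_span_finset_le_card T
  have h3 : T.card ≤ ρ.card := Finset.card_image_le
  have h4 : Module.finrank ℚ (Submodule.span ℚ {(Pi.single 0 1 : Fin (r + 1) → ℚ)}) ≤ 1 := by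
    refine (finrank_span_le_card _).trans ?_
    simp
  omega

theorem isCompleteIntersection_of_mul_mem_closure {s : ℕ} {g p : Fin (s + 1) → ℕ}
    (hg : StrictMono g) (hpos : ∀ i, 0 < g i) (hndvd : ∀ i, ¬ (Finset.Iio i).gcd g ∣ g i)
    (hmem : ∀ i, p i * g i ∈ AddSubmonoid.closure (g '' Set.Iio i))
    (hdvd : ∀ i t, (Finset.Iio i).gcd g ∣ t * g i → p i ∣ t) :
    IsCompleteIntersection (AddSubmonoid.closure (Set.range g)) := by
  classical
  refine ⟨s + 1, g, isMinimalGeneratorSequence_of_not_gcd_dvd hg hndvd, s, rfl, ?_, ?_⟩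
  · choose r hr hrg using fun i => exists_factorization_of_mem_closure (hmem i)
    replace hr : ∀ i j, i ≤ j → r i j = 0 := fun i j hij => hr i j (not_lt.2 hij)
    let ρ : Finset ((Fin (s + 1) → ℕ) × (Fin (s + 1) → ℕ)) :=
      Finset.univ.image fun i : Fin s => (Pi.single i.succ (p i.succ), r i.succ)
    have hρ : IsPresentation g (ρ : Set ((Fin (s + 1) → ℕ) × (Fin (s + 1) → ℕ))) := by
      refine le_antisymm (AddCon.addConGen_le.2 fun x y hxy => ?_) fun x y hxy => ?_
      · obtain ⟨i, -, hi⟩ := Finset.mem_image.1 (Finset.mem_coe.1 hxy)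
        rw [Prod.mk.injEq] at hi
        obtain ⟨rfl, rfl⟩ := hi
        rw [AddCon.ker_rel, factorizationHom_single, hrg]
      · refine addCon_of_factorizationHom_eq _ hr hrg (fun i => ?_) hdvd (s + 1) le_rfl x y
          (fun j hj => absurd j.2 (by omega)) (fun j hj => absurd j.2 (by omega)) hxy
        -- The index 0 contributes no element of `ρ`: there `p 0 = 0` and the relation reads 0 = 0.
        refine Fin.cases ?_ (fun i => ?_) i
        · have h1 : r 0 = 0 := funext fun j => hr 0 j (Fin.zero_le j)
          have h2 : p 0 = 0 := by
            have := hrg 0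
            rw [h1, map_zero, eq_comm, mul_eq_zero] at this
            exact this.resolve_right (hpos 0).ne'
          rw [h1, h2, Pi.single_zero]
          exact AddCon.refl _ _
        · exact AddConGen.Rel.of _ _ (Finset.mem_coe.2 (Finset.mem_image.2
            ⟨i, Finset.mem_univ _, rfl⟩))
    refine ⟨ρ, le_antisymm ?_ (le_card_of_isPresentation (hpos 0) hρ), hρ⟩
    simpa using Finset.card_image_le (s := (Finset.univ : Finset (Fin s)))
      (f := fun i : Fin s => ((Pi.single i.succ (p i.succ) : Fin (s + 1) → ℕ), r i.succ))
  · rintro k ⟨ρ, rfl, hρ⟩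
    exact le_card_of_isPresentation (hpos 0) hρ

/-! ### Normalized binomial coefficients and the descent on divisors. -/

/-- The binomial coefficient `n.choose k` divided by `binomialDivisor n`. -/
noncomputable def normalizedChoose (n k : ℕ) : ℕ := n.choose k / binomialDivisor n

theorem binomialDivisor_pos (n : ℕ) : 0 < binomialDivisor n := by
  rw [binomialDivisor]
  split_ifs
  · exact n.minFac_pos
  · exact one_pos

theorem binomialDivisor_mul_normalizedChoose {n k : ℕ} (hk : 0 < k) (hkn : k < n) :
    binomialDivisor n * normalizedChoose n k = n.choose k :=
  Nat.mul_div_cancel' (binomialDivisor_dvd_choose hk hkn)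

theorem normalizedChoose_pos {n k : ℕ} (hk : 0 < k) (hkn : k < n) : 0 < normalizedChoose n k := by
  refine Nat.pos_of_ne_zero fun h => ?_
  have := binomialDivisor_mul_normalizedChoose hk hkn
  rw [h, mul_zero] at this
  exact (Nat.choose_pos hkn.le).ne this

theorem normalizedChoose_lt_of_two_mul_le {n a b : ℕ} (ha : 0 < a) (hab : a < b)
    (hb : 2 * b ≤ n) : normalizedChoose n a < normalizedChoose n b := by
  refine lt_of_mul_lt_mul_left (a := binomialDivisor n) ?_ (Nat.zero_le _)
  rw [binomialDivisor_mul_normalizedChoose ha (by omega),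
    binomialDivisor_mul_normalizedChoose (by omega) (by omega)]
  exact Nat.choose_lt_choose_of_two_mul_le hab hb

theorem mul_choose_eq_mul_choose_pred {n k : ℕ} (hk : 0 < k) (hkn : k < n) :
    k * n.choose k = n * (n - 1).choose (k - 1) := by
  obtain ⟨n, rfl⟩ := Nat.exists_eq_add_of_le' (by omega : 1 ≤ n)
  obtain ⟨k, rfl⟩ := Nat.exists_eq_add_of_le' (by omega : 1 ≤ k)
  rw [Nat.add_sub_cancel, Nat.add_sub_cancel, Nat.add_one_mul_choose_eq, mul_comm]

theorem mul_normalizedChoose {n k : ℕ} (hk : 0 < k) (hkn : k < n) :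
    k * normalizedChoose n k = normalizedChoose n 1 * (n - 1).choose (k - 1) := by
  refine Nat.eq_of_mul_eq_mul_left (binomialDivisor_pos n) ?_
  rw [mul_left_comm, binomialDivisor_mul_normalizedChoose hk hkn, ← mul_assoc,
    binomialDivisor_mul_normalizedChoose one_pos (by omega), Nat.choose_one_right,
    mul_choose_eq_mul_choose_pred hk hkn]

theorem normalizedChoose_one_dvd_gcd_mul {n k : ℕ} (hk : 0 < k) (hkn : k < n) :
    normalizedChoose n 1 ∣ Nat.gcd n k * normalizedChoose n k := by
  rw [← Nat.gcd_mul_right]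
  refine Nat.dvd_gcd (Dvd.dvd.mul_right ?_ _) ⟨_, mul_normalizedChoose hk hkn⟩
  refine ⟨binomialDivisor n, ?_⟩
  rw [mul_comm, binomialDivisor_mul_normalizedChoose one_pos (by omega), Nat.choose_one_right]

theorem exists_lt_mul_modEq {p a : ℕ} (hp : p.Prime) (ha : ¬ p ∣ a) (y : ℕ) :
    ∃ c < p, c * a ≡ y [MOD p] := by
  have : Fact p.Prime := ⟨hp⟩
  have ha' : (a : ZMod p) ≠ 0 := by rwa [Ne, ZMod.natCast_eq_zero_iff]
  refine ⟨((y : ZMod p) * (a : ZMod p)⁻¹).val, ZMod.val_lt _, ?_⟩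
  rw [← ZMod.natCast_eq_natCast_iff, Nat.cast_mul, ZMod.natCast_zmod_val, mul_assoc,
    inv_mul_cancel₀ ha', mul_one]

/-- Descent from m to m / p, where p is the least prime factor of m and q the full power of p in m:
subtract c·G(q) with c < p so that G(1) divides (m / p)·(x - c·G(q)). Since c ≤ q - 1 and q ∤ m / p,
the term of q in the sum pays for the subtraction. -/
theorem mem_closure_normalizedChoose_of_sum_le {n : ℕ} (m : ℕ) :
    0 < m → m ∣ n → m < n → ∀ x, normalizedChoose n 1 ∣ m * x →
      ∑ q ∈ m.divisors with IsPrimePow q, (q - 1) * normalizedChoose n q ≤ x →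
      x ∈ AddSubmonoid.closure (normalizedChoose n '' {q | q ∣ m ∧ (q = 1 ∨ IsPrimePow q)}) := by
  induction m using Nat.strong_induction_on with
  | _ m ih =>
  intro hm0 hmn hmlt x hdvd hsum
  rcases eq_or_ne m 1 with rfl | hm1
  · obtain ⟨t, rfl⟩ := (one_mul x ▸ hdvd)
    rw [mul_comm, ← smul_eq_mul]
    refine nsmul_mem (AddSubmonoid.subset_closure ?_) t
    exact ⟨1, ⟨dvd_rfl, Or.inl rfl⟩, rfl⟩
  set p := m.minFac with hp_def
  have hp : p.Prime := Nat.minFac_prime hm1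
  have hpm : p ∣ m := Nat.minFac_dvd m
  set q := p ^ m.factorization p with hq
  set m' := m / q with hm'
  have hqm' : q * m' = m := Nat.ordProj_mul_ordCompl_eq_self m p
  have hpm' : ¬ p ∣ m' := Nat.not_dvd_ordCompl hp hm0.ne'
  have hqm : q ∣ m := ⟨m', hqm'.symm⟩
  have hq0 : 0 < q := pow_pos hp.pos _
  have hqlt : q < n := (Nat.le_of_dvd hm0 hqm).trans_lt hmlt
  have hqpp : IsPrimePow q :=
    hp.isPrimePow.pow ((hp.factorization_pos_of_dvd hm0.ne' hpm).ne')
  have hpq : p ≤ q := by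
    refine Nat.le_of_dvd hq0 ?_
    exact dvd_pow_self _ ((hp.factorization_pos_of_dvd hm0.ne' hpm).ne')
  set u := (n - 1).choose (q - 1) with hu
  have hpu : ¬ p ∣ u := not_dvd_choose_pred_prime_pow_pred hp _ (by omega) (hqm.trans hmn)
  obtain ⟨m₁, hm₁⟩ := hpm
  have hm₁0 : 0 < m₁ := Nat.pos_of_ne_zero (by rintro rfl; omega)
  have hm₁lt : m₁ < m := by
    rw [hm₁]
    exact lt_mul_of_one_lt_left hm₁0 hp.one_lt
  have hm₁m : m₁ ∣ m := ⟨p, by rw [mul_comm]; exact hm₁⟩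
  have hqm₁ : ¬ q ∣ m₁ := by
    rintro ⟨t, ht⟩
    refine hpm' ⟨t, Nat.eq_of_mul_eq_mul_left hq0 ?_⟩
    rw [hqm', hm₁, ht]
    ring
  obtain ⟨y, hy⟩ := hdvd
  -- As m·G(q) = m'·u·G(1), subtracting c·G(q) from x replaces y by y - c·m'·u, which must be
  -- divisible by p.
  obtain ⟨c, hcp, hc⟩ := exists_lt_mul_modEq hp (a := m' * u)
    (fun h => (hp.dvd_mul.1 h).elim hpm' hpu) y
  have hle : (q - 1) * normalizedChoose n q +
      ∑ q ∈ m₁.divisors with IsPrimePow q, (q - 1) * normalizedChoose n q ≤ x := by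
    refine le_trans ?_ hsum
    have hmem : q ∈ m.divisors.filter IsPrimePow := by
      simp [hqm, hm0.ne', hqpp]
    rw [← Finset.add_sum_erase _ _ hmem]
    refine Nat.add_le_add_left (Finset.sum_le_sum_of_subset fun a ha => ?_) _
    simp only [Finset.mem_filter, Nat.mem_divisors] at ha
    simp only [Finset.mem_erase, Finset.mem_filter, Nat.mem_divisors]
    exact ⟨fun h => hqm₁ (h ▸ ha.1.1), ⟨ha.1.1.trans hm₁m, hm0.ne'⟩, ha.2⟩
  have hcle : c * normalizedChoose n q ≤ (q - 1) * normalizedChoose n q :=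
    Nat.mul_le_mul_right _ (by omega)
  obtain ⟨z, rfl⟩ := Nat.exists_eq_add_of_le
    (hcle.trans ((Nat.le_add_right _ _).trans hle))
  have hGq : q * normalizedChoose n q = normalizedChoose n 1 * u := mul_normalizedChoose hq0 hqlt
  have hz : normalizedChoose n 1 ∣ m₁ * z := by
    obtain ⟨w, hw⟩ := (Nat.modEq_iff_dvd.1 hc)
    rw [← Int.natCast_dvd_natCast]
    refine ⟨w, ?_⟩
    have hp0 : (p : ℤ) ≠ 0 := by exact_mod_cast hp.ne_zero
    refine mul_left_cancel₀ hp0 ?_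
    have h1 : (m : ℤ) * (c * normalizedChoose n q + z) = normalizedChoose n 1 * y := by
      exact_mod_cast hy
    have h2 : (q : ℤ) * normalizedChoose n q = normalizedChoose n 1 * u := by exact_mod_cast hGq
    have h3 : (q : ℤ) * m' = m := by exact_mod_cast hqm'
    have h4 : (m : ℤ) = p * m₁ := by exact_mod_cast hm₁
    push_cast at hw ⊢
    linear_combination h1 + (normalizedChoose n 1 : ℤ) * hw - c * m' * h2 +
      (c * normalizedChoose n q : ℤ) * h3 - z * h4
  have hmem := ih m₁ hm₁lt hm₁0 (hm₁m.trans hmn) (hm₁lt.trans hmlt) z hz (by omega)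
  refine add_mem ?_ (AddSubmonoid.closure_mono (Set.image_mono ?_) hmem)
  · rw [← smul_eq_mul]
    refine nsmul_mem (AddSubmonoid.subset_closure ?_) c
    exact ⟨q, ⟨hqm, Or.inr hqpp⟩, rfl⟩
  · exact fun a ha => ⟨ha.1.trans hm₁m, ha.2⟩

theorem sum_pred_mul_normalizedChoose_le {n m k : ℕ} (hk : 0 < k) (hkn : 2 * k ≤ n)
    (hm : ∀ q, q ∣ m → IsPrimePow q → 2 * q ≤ k) :
    ∑ q ∈ m.divisors with IsPrimePow q, (q - 1) * normalizedChoose n q ≤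
      normalizedChoose n k := by
  refine le_of_mul_le_mul_left (a := binomialDivisor n) ?_ (binomialDivisor_pos n)
  rw [binomialDivisor_mul_normalizedChoose hk (by omega), Finset.mul_sum]
  have hq : ∀ q ∈ m.divisors.filter IsPrimePow, 0 < q ∧ 2 * q ≤ k := fun q hq => by
    simp only [Finset.mem_filter, Nat.mem_divisors] at hq
    exact ⟨hq.2.pos, hm q hq.1.1 hq.2⟩
  calc ∑ q ∈ m.divisors with IsPrimePow q, binomialDivisor n * ((q - 1) * normalizedChoose n q)
      = ∑ q ∈ m.divisors with IsPrimePow q, (q - 1) * n.choose q := by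
        refine Finset.sum_congr rfl fun q h => ?_
        have := hq q h
        rw [mul_left_comm, binomialDivisor_mul_normalizedChoose this.1 (by omega)]
    _ ≤ ∑ j ∈ Finset.range (k / 2 + 1), (j - 1) * n.choose j := by
        refine Finset.sum_le_sum_of_subset fun q h => ?_
        have := hq q h
        rw [Finset.mem_range]
        omega
    _ ≤ n.choose k := sum_pred_mul_choose_le (by omega) hkn

/-! ### The generators and the relations among them. -/

/-- The proper divisors of `n` that are `1` or a prime power: they index the minimal generators
of `binomialSemigroup n`. -/
noncomputable def generatorIndices (n : ℕ) : Finset ℕ :=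
  open Classical in n.properDivisors.filter fun q => q = 1 ∨ IsPrimePow q

theorem mem_generatorIndices {n q : ℕ} :
    q ∈ generatorIndices n ↔ (q ∣ n ∧ q < n) ∧ (q = 1 ∨ IsPrimePow q) := by
  simp [generatorIndices]

theorem pos_of_mem_generatorIndices {n q : ℕ} (hq : q ∈ generatorIndices n) : 0 < q := by
  obtain ⟨⟨h, hlt⟩, -⟩ := mem_generatorIndices.1 hq
  exact Nat.pos_of_dvd_of_pos h (by omega)

theorem two_mul_le_of_dvd_of_lt {q n : ℕ} (h : q ∣ n) (hlt : q < n) : 2 * q ≤ n := by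
  obtain ⟨t, rfl⟩ := h
  rcases t with _ | _ | t
  · simp at hlt
  · simp at hlt
  · nlinarith

theorem two_mul_le_of_mem_generatorIndices {n q : ℕ} (hq : q ∈ generatorIndices n) :
    2 * q ≤ n := by
  obtain ⟨⟨h, hlt⟩, -⟩ := mem_generatorIndices.1 hq
  exact two_mul_le_of_dvd_of_lt h hlt

/-- Apply the descent with m = gcd(n, k). When k is not itself an index, every prime power dividing
m is a proper divisor of k, hence at most k / 2, as the size estimate needs. -/
theorem normalizedChoose_mem_closure {n k : ℕ} (hk : 0 < k) (hkn : 2 * k ≤ n) :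
    normalizedChoose n k ∈ AddSubmonoid.closure (normalizedChoose n '' generatorIndices n) := by
  by_cases hT : k ∈ generatorIndices n
  · exact AddSubmonoid.subset_closure ⟨k, hT, rfl⟩
  have hm0 : 0 < Nat.gcd n k := Nat.gcd_pos_of_pos_right _ hk
  have hmlt : Nat.gcd n k < n := (Nat.gcd_le_right n hk).trans_lt (by omega)
  have hmem : ∀ q, q ∣ Nat.gcd n k → (q = 1 ∨ IsPrimePow q) → q ∈ generatorIndices n :=
    fun q hq hq' => mem_generatorIndices.2
      ⟨⟨hq.trans (Nat.gcd_dvd_left _ _), (Nat.le_of_dvd hm0 hq).trans_lt hmlt⟩, hq'⟩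
  refine AddSubmonoid.closure_mono (Set.image_mono fun q hq => hmem q hq.1 hq.2)
    (mem_closure_normalizedChoose_of_sum_le (Nat.gcd n k) hm0 (Nat.gcd_dvd_left _ _) hmlt _
      (normalizedChoose_one_dvd_gcd_mul hk (by omega))
      (sum_pred_mul_normalizedChoose_le hk hkn fun q hq hpp => ?_))
  have hqk : q ∣ k := hq.trans (Nat.gcd_dvd_right _ _)
  refine two_mul_le_of_dvd_of_lt hqk ((Nat.le_of_dvd hk hqk).lt_of_ne ?_)
  rintro rfl
  exact hT (hmem q hq (Or.inr hpp))

theorem binomialSemigroup_eq_closure (n : ℕ) :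
    binomialSemigroup n = AddSubmonoid.closure (normalizedChoose n '' generatorIndices n) := by
  refine le_antisymm (AddSubmonoid.closure_le.2 ?_) (AddSubmonoid.closure_mono ?_)
  · rintro _ ⟨k, ⟨hk, hkn⟩, rfl⟩
    change normalizedChoose n k ∈ AddSubmonoid.closure _
    rcases Nat.le_total (2 * k) n with h | h
    · exact normalizedChoose_mem_closure hk h
    · rw [normalizedChoose, ← Nat.choose_symm hkn.le]
      exact normalizedChoose_mem_closure (by omega) (by omega)
  · rintro _ ⟨q, hq, rfl⟩
    exact ⟨q, ⟨pos_of_mem_generatorIndices hq, (mem_generatorIndices.1 hq).1.2⟩, rfl⟩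

/-- The descent with m = q / p and x = p·G(q), since m·x = q·G(q) is a multiple of G(1). -/
theorem minFac_mul_normalizedChoose_mem_closure {n q : ℕ} (hq : q ∈ generatorIndices n)
    (hpp : IsPrimePow q) :
    q.minFac * normalizedChoose n q ∈
      AddSubmonoid.closure (normalizedChoose n '' {r | r ∈ generatorIndices n ∧ r < q}) := by
  obtain ⟨⟨hqn, hlt⟩, -⟩ := mem_generatorIndices.1 hq
  have h2 := two_mul_le_of_mem_generatorIndices hq
  have hq0 := hpp.pos
  have hp : q.minFac.Prime := Nat.minFac_prime hpp.ne_one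
  obtain ⟨m, hm⟩ := Nat.minFac_dvd q
  have hm0 : 0 < m := Nat.pos_of_ne_zero fun h => by rw [h, mul_zero] at hm; omega
  have hmq : m ∣ q := ⟨q.minFac, by rw [mul_comm]; exact hm⟩
  have hmlt : m < q := by
    exact (lt_mul_of_one_lt_left hm0 hp.one_lt).trans_eq hm.symm
  refine AddSubmonoid.closure_mono (Set.image_mono fun r hr => ?_)
    (mem_closure_normalizedChoose_of_sum_le m hm0 (hmq.trans hqn) (hmlt.trans hlt) _ ?_ ?_)
  · have : r ≤ m := Nat.le_of_dvd hm0 hr.1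
    exact ⟨mem_generatorIndices.2 ⟨⟨hr.1.trans (hmq.trans hqn), by omega⟩, hr.2⟩, by omega⟩
  · rw [← mul_assoc, mul_comm m, ← hm]
    exact ⟨_, mul_normalizedChoose hq0 hlt⟩
  · refine (sum_pred_mul_normalizedChoose_le hq0 h2 fun r hr _ => ?_).trans
      (Nat.le_mul_of_pos_left _ hp.pos)
    exact two_mul_le_of_dvd_of_lt (hr.trans hmq) ((Nat.le_of_dvd hm0 hr).trans_lt hmlt)

theorem dvd_prime_pow_pred_mul_ordCompl {n p a q : ℕ} (hp : p.Prime)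
    (hq : q = 1 ∨ IsPrimePow q) (hqn : q ∣ n) (hlt : q < p ^ a) :
    q ∣ p ^ (a - 1) * (n / p ^ n.factorization p) := by
  rcases hq with rfl | hq
  · exact one_dvd _
  obtain ⟨r, b, hr, hb, rfl⟩ := (isPrimePow_nat_iff q).1 hq
  rcases eq_or_ne r p with rfl | hne
  · have : b < a := (Nat.pow_lt_pow_iff_right hr.one_lt).1 hlt
    exact (pow_dvd_pow _ (by omega)).mul_right _
  · refine Dvd.dvd.mul_left ?_ _
    rw [← Nat.ordProj_mul_ordCompl_eq_self n p] at hqn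
    exact (Nat.Coprime.pow _ _ ((Nat.coprime_primes hr hp).2 hne)).dvd_of_dvd_mul_left hqn

/-- Let q = p^a and n' be the prime-to-p part of n. Every index below q divides p^(a-1)·n', so G(1)
divides p^(a-1)·n' times the gcd, hence p^(a-1)·n'·t·G(q). Multiplying by p and cancelling G(1)
gives p ∣ n'·t·C(n-1, q-1), where only t can be divisible by p. -/
theorem minFac_dvd_of_gcd_dvd_mul {ι : Type*} {n q t : ℕ} {s : Finset ι} {f : ι → ℕ}
    (hf : ∀ j ∈ s, f j ∈ generatorIndices n ∧ f j < q) (hq : q ∈ generatorIndices n)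
    (hpp : IsPrimePow q)
    (ht : s.gcd (fun j => normalizedChoose n (f j)) ∣ t * normalizedChoose n q) :
    q.minFac ∣ t := by
  obtain ⟨⟨hqn, hlt⟩, -⟩ := mem_generatorIndices.1 hq
  obtain ⟨p, a, hp, ha, rfl⟩ := (isPrimePow_nat_iff q).1 hpp
  rw [hp.pow_minFac (by omega)]
  set N := normalizedChoose n 1 with hN
  set n' := n / p ^ n.factorization p
  have hn0 : n ≠ 0 := by omega
  have hpn' : ¬ p ∣ n' := Nat.not_dvd_ordCompl hp hn0
  have hq0 : 0 < p ^ a := pow_pos hp.pos a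
  have hN0 : 0 < N := normalizedChoose_pos one_pos (by omega)
  have h1 : N ∣ p ^ (a - 1) * n' * s.gcd (fun j => normalizedChoose n (f j)) := by
    have h : N ∣ s.gcd (fun j => p ^ (a - 1) * n' * normalizedChoose n (f j)) := by
      refine Finset.dvd_gcd fun j hj => ?_
      obtain ⟨hj, hjq⟩ := hf j hj
      have hj' := mem_generatorIndices.1 hj
      refine dvd_trans ⟨_, mul_normalizedChoose (pos_of_mem_generatorIndices hj) hj'.1.2⟩ ?_
      exact Nat.mul_dvd_mul_right (dvd_prime_pow_pred_mul_ordCompl hp hj'.2 hj'.1.1 hjq) _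
    rwa [Finset.gcd_mul_left, normalize_eq] at h
  have h2 : N ∣ p ^ (a - 1) * n' * (t * normalizedChoose n (p ^ a)) :=
    h1.trans (mul_dvd_mul_left _ ht)
  have h3 : N * p ∣ N * (n' * t * (n - 1).choose (p ^ a - 1)) := by
    have h4 : N * p ∣ p ^ (a - 1) * n' * (t * normalizedChoose n (p ^ a)) * p :=
      mul_dvd_mul_right h2 p
    convert h4 using 1
    calc N * (n' * t * (n - 1).choose (p ^ a - 1))
        = n' * t * (N * (n - 1).choose (p ^ a - 1)) := by ring
      _ = n' * t * (p ^ (a - 1) * p * normalizedChoose n (p ^ a)) := by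
          rw [← mul_normalizedChoose hq0 hlt, ← pow_succ, Nat.sub_add_cancel (by omega : 1 ≤ a)]
      _ = p ^ (a - 1) * n' * (t * normalizedChoose n (p ^ a)) * p := by ring
  have h5 : p ∣ n' * t * (n - 1).choose (p ^ a - 1) := Nat.dvd_of_mul_dvd_mul_left hN0 h3
  have h6 := not_dvd_choose_pred_prime_pow_pred hp a (by omega : 0 < n) hqn
  exact (hp.dvd_mul.1 ((hp.dvd_mul.1 h5).resolve_right h6)).resolve_left hpn'

/-! ### Coprimality of the generators and the conclusion. -/

/-- Take k to be the full power of r in n. If that power is n itself, take k = n / r: the division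
by r in the normalization makes G(1) = k, so G(k) = C(n-1, k-1). -/
theorem exists_not_dvd_normalizedChoose {n r : ℕ} (hn : 2 ≤ n) (hr : r.Prime) :
    ∃ k, 0 < k ∧ k < n ∧ ¬ r ∣ normalizedChoose n k := by
  by_cases hrn : r ∣ n
  · set v := n.factorization r with hv
    have hv1 : 1 ≤ v := hr.factorization_pos_of_dvd (by omega) hrn
    have hmul : r ^ v * (n / r ^ v) = n := Nat.ordProj_mul_ordCompl_eq_self n r
    have hvn : r ^ v ∣ n := ⟨_, hmul.symm⟩
    have hpos : 0 < r ^ v := pow_pos hr.pos v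
    rcases (Nat.le_of_dvd (by omega) hvn).eq_or_lt with heq | hlt
    · have hpos' : 0 < r ^ (v - 1) := pow_pos hr.pos _
      have hlt : r ^ (v - 1) < n := by
        rw [← heq]
        exact Nat.pow_lt_pow_right hr.one_lt (by omega)
      have hpow : r ^ (v - 1) * r = n := by
        rw [← pow_succ, Nat.sub_add_cancel hv1, heq]
      have hd : binomialDivisor n = r := by
        rw [← heq]
        exact binomialDivisor_prime_pow hr hv1
      have hN : r * normalizedChoose n 1 = n := by
        have := binomialDivisor_mul_normalizedChoose one_pos (by omega : 1 < n)
        rwa [hd, Nat.choose_one_right] at this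
      have hN' : normalizedChoose n 1 = r ^ (v - 1) := by
        refine Nat.eq_of_mul_eq_mul_left hr.pos ?_
        rw [hN, mul_comm, hpow]
      refine ⟨r ^ (v - 1), hpos', hlt, ?_⟩
      have h := mul_normalizedChoose hpos' hlt
      rw [hN'] at h
      rw [Nat.eq_of_mul_eq_mul_left hpos' h]
      exact not_dvd_choose_pred_prime_pow_pred hr _ (by omega) ⟨r, hpow.symm⟩
    · refine ⟨r ^ v, hpos, hlt, fun h => ?_⟩
      have h1 : r ∣ n.choose (r ^ v) := by
        rw [← binomialDivisor_mul_normalizedChoose hpos hlt]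
        exact h.mul_left _
      have h2 := mul_choose_eq_mul_choose_pred hpos hlt
      nth_rewrite 2 [← hmul] at h2
      rw [mul_assoc] at h2
      rw [Nat.eq_of_mul_eq_mul_left hpos h2] at h1
      rcases hr.dvd_mul.1 h1 with h3 | h3
      · exact Nat.not_dvd_ordCompl hr (by omega) h3
      · exact not_dvd_choose_pred_prime_pow_pred hr _ (by omega) hvn h3
  · refine ⟨1, one_pos, by omega, fun h => hrn ?_⟩
    have := binomialDivisor_mul_normalizedChoose one_pos (by omega : 1 < n)
    rw [Nat.choose_one_right] at this
    rw [← this]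
    exact h.mul_left _

theorem isNumericalSemigroup_binomialSemigroup {n : ℕ} (hn : 2 ≤ n) :
    IsNumericalSemigroup (binomialSemigroup n) := by
  set A := normalizedChoose n '' Set.Ioo 0 n with hA
  have hgcd : Nat.setGcd A = 1 := by
    by_contra h
    obtain ⟨r, hr, hrd⟩ := Nat.exists_prime_and_dvd h
    obtain ⟨k, hk, hkn, hndvd⟩ := exists_not_dvd_normalizedChoose hn hr
    exact hndvd (Nat.dvd_setGcd_iff.1 hrd _ ⟨k, ⟨hk, hkn⟩, rfl⟩)
  obtain ⟨b, hb⟩ := Nat.exists_mem_closure_of_ge A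
  refine (Set.finite_lt_nat b).subset fun x hx => ?_
  by_contra hxb
  exact hx (hb x (not_lt.1 hxb) (hgcd ▸ one_dvd x))

theorem mainTheorem8 (n : ℕ) (hn : 2 ≤ n) :
    IsNumericalSemigroup (binomialSemigroup n) ∧
      IsTelescopic (binomialSemigroup n) ∧
      IsCompleteIntersection (binomialSemigroup n) := by
  have h1 : 1 ∈ generatorIndices n :=
    mem_generatorIndices.2 ⟨⟨one_dvd n, by omega⟩, Or.inl rfl⟩
  obtain ⟨s, hs⟩ := Nat.exists_eq_add_of_le' (Finset.card_pos.2 ⟨1, h1⟩)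
  let q : Fin (s + 1) ↪o ℕ := (generatorIndices n).orderEmbOfFin hs
  have hqT : ∀ i, q i ∈ generatorIndices n := Finset.orderEmbOfFin_mem _ hs
  have hqrange : Set.range q = generatorIndices n := Finset.range_orderEmbOfFin _ hs
  have hqpp : ∀ i, i ≠ 0 → IsPrimePow (q i) := fun i hi => by
    refine (mem_generatorIndices.1 (hqT i)).2.resolve_left fun h => ?_
    have hlt : q 0 < q i := q.strictMono (Fin.pos_iff_ne_zero.2 hi)
    have := pos_of_mem_generatorIndices (hqT 0)
    omega
  let g : Fin (s + 1) → ℕ := fun i => normalizedChoose n (q i)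
  -- The value 0 at index 0 fits the convention that the empty gcd is 0: 0 ∣ t·g₀ forces t = 0.
  let p : Fin (s + 1) → ℕ := fun i => if i = 0 then 0 else (q i).minFac
  have hg : StrictMono g := fun i j hij =>
    normalizedChoose_lt_of_two_mul_le (pos_of_mem_generatorIndices (hqT i)) (q.strictMono hij)
      (two_mul_le_of_mem_generatorIndices (hqT j))
  have hpos : ∀ i, 0 < g i := fun i =>
    normalizedChoose_pos (pos_of_mem_generatorIndices (hqT i))
      (mem_generatorIndices.1 (hqT i)).1.2
  have hdvd : ∀ i t, (Finset.Iio i).gcd g ∣ t * g i → p i ∣ t := by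
    intro i t ht
    by_cases hi : i = 0
    · subst hi
      have h0 : (Finset.Iio (0 : Fin (s + 1))) = ∅ :=
        Finset.eq_empty_of_forall_notMem fun j hj => Fin.not_lt_zero j (Finset.mem_Iio.1 hj)
      rw [h0, Finset.gcd_empty, zero_dvd_iff, mul_eq_zero] at ht
      rw [ht.resolve_right (hpos 0).ne']
      exact dvd_zero _
    · simp only [p, if_neg hi]
      exact minFac_dvd_of_gcd_dvd_mul
        (fun j hj => ⟨hqT j, q.strictMono (Finset.mem_Iio.1 hj)⟩) (hqT i) (hqpp i hi) ht
  have hndvd : ∀ i, ¬ (Finset.Iio i).gcd g ∣ g i := by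
    intro i hi
    have h := hdvd i 1 (by rwa [one_mul])
    by_cases hi0 : i = 0
    · simp [p, hi0] at h
    · simp only [p, if_neg hi0, Nat.dvd_one, Nat.minFac_eq_one_iff] at h
      exact (hqpp i hi0).ne_one h
  have hmem : ∀ i, p i * g i ∈ AddSubmonoid.closure (g '' Set.Iio i) := by
    intro i
    by_cases hi : i = 0
    · simp [p, hi]
    · simp only [p, if_neg hi]
      refine AddSubmonoid.closure_mono ?_
        (minFac_mul_normalizedChoose_mem_closure (hqT i) (hqpp i hi))
      rintro _ ⟨r, ⟨hr, hri⟩, rfl⟩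
      obtain ⟨j, rfl⟩ : r ∈ Set.range q := hqrange ▸ hr
      exact ⟨j, q.strictMono.lt_iff_lt.1 hri, rfl⟩
  have hS : binomialSemigroup n = AddSubmonoid.closure (Set.range g) := by
    rw [binomialSemigroup_eq_closure, ← hqrange, ← Set.range_comp]
    rfl
  refine ⟨isNumericalSemigroup_binomialSemigroup hn, ?_, ?_⟩
  · rw [hS]
    exact isTelescopic_of_mul_mem_closure hg hpos hndvd hmem hdvd
  · rw [hS]
    exact isCompleteIntersection_of_mul_mem_closure hg hpos hndvd hmem hdvd
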